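/- Ordinals carry the order topology, and an ordinal is identified with the set of all smaller ordinals. A continuous map $f:X\to Y$ \emph{cleaves along} $A\subseteq X$ if $f(A)\cap f(X\setminus A)=\emptyset$; $X$ is \emph{cleavable over} $Y$ if for every $A\subseteq X$ some continuous $f:X\to Y$ cleaves along $A$. Let $X^{0}=X$, $X^{\alpha+1}=(X^{\alpha})'$ and $X^{\gamma}=\bigcap_{\alpha<\gamma}X^{\alpha}$ for limit $\gamma$ be the derived sets of $X$, and let the Cantor--Bendixson rank $\mathrm{CB}(X)$ be the least $\alpha$ with $X^{\alpha+1}=X^{\alpha}$. A compact space $X$ is \emph{simple with $\hat x$} if $\mathrm{CB}(X)=\beta+1$ for some $\beta$ with $X^{\beta}=\{\hat x\}$ (such an $X$ is scattered), and \emph{simple} if it is simple with some point. Let $X$ be compact and simple with $\hat x$, and let $\lambda$ be an ordinal. A \emph{spine} of $X$ over $\lambda$ is a pair $(S,k)$ with $S\subseteq X\setminus\{\hat x\}$ and $k:X\to\lambda$ continuous such that (1) $k$ cleaves along $S$; (2) $k|_S$ is an embedding into $\lambda$; (3) $k(\hat x)$ is a limit ordinal, and $k(S)$ is a closed unbounded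 subset of $k(\hat x)$. \textbf{Theorem.} Let $\lambda$ be an ordinal and let $X$ be an infinite compact space that is cleavable over $\lambda$ and simple with $\hat x$. Then: (a) $X$ has a spine $(S,k)$ over $\lambda$ such that $S\cup\{\hat x\}$ is closed in $X$. (b) $X$ hereditarily has a spine: every closed, infinite subspace $A\subseteq X$ that is simple, say with $\hat a$, has a spine $(S,k)$ over $\lambda$ such that $S\cup\{\hat a\}$ is closed in $A$. -/

import Mathlib

open Set Topology CantorBendixson

universe u v

/-- The continuous map `f : X → Y` cleaves along `A ⊆ X`: `f(A) ∩ f(X \ A) = ∅`. -/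
def CleavesAlong {X : Type u} {Y : Type v} [TopologicalSpace X] [TopologicalSpace Y]
    (f : X → Y) (A : Set X) : Prop :=
  Continuous f ∧ f '' A ∩ f '' Aᶜ = ∅

/-- `X` is cleavable over `Y`: for every `A ⊆ X` some continuous `f : X → Y` cleaves along `A`. -/
def CleavableOver (X : Type u) (Y : Type v) [TopologicalSpace X] [TopologicalSpace Y] : Prop :=
  ∀ A : Set X, ∃ f : X → Y, CleavesAlong f A

/-- The Cantor-Bendixson rank of `X`: the least `α` with `X^(α+1) = X^α`, where `X^α` is the `α`-th
derived set of `X`. (The derived sets stabilise below the successor of the cardinality of the power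
set of `X`, so ordinals of the universe of `X` suffice.) -/
noncomputable def cbRank (X : Type u) [TopologicalSpace X] : Ordinal.{u} :=
  sInf {α | (univ : Set X)ᵈ[α + 1] = (univ : Set X)ᵈ[α]}

/-- `X` is simple with `x`: the Cantor-Bendixson rank of `X` is a successor `β + 1` and `x` is the
only element of `X^β`. Such a space is scattered, see `IsSimpleWith.scattered`. -/
def IsSimpleWith (X : Type u) [TopologicalSpace X] (x : X) : Prop :=
  ∃ β : Ordinal.{u}, cbRank X = β + 1 ∧ (univ : Set X)ᵈ[β] = {x}

/-- In a simple space no nonempty subset is dense in itself. -/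
theorem IsSimpleWith.scattered {X : Type u} [TopologicalSpace X] {x : X} (h : IsSimpleWith X x)
    (s : Set X) (hs : s.Nonempty) : ¬ Preperfect s := by
  obtain ⟨β, -, hβ⟩ := h
  intro hp
  have h1 : s ⊆ (univ : Set X)ᵈ[β + 1] := by
    rw [← iteratedDerivedSet_constant_iff_preperfect.1 hp (β + 1)]
    exact iteratedDerivedSet_mono (subset_univ s) (β + 1)
  obtain ⟨y, hy⟩ := hs
  have h2 := h1 hy
  rw [iteratedDerivedSet_succ, hβ, relDerivedSet_apply] at h2
  obtain ⟨h3, rfl⟩ := h2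
  rw [mem_derivedSet, accPt_iff_frequently] at h3
  exact h3 (Filter.Eventually.of_forall fun z hz => hz.1 hz.2)

/-- `C` is club in the element `m` of the ordinal `l` (the ordinal `l` being the space of all
ordinals below `l`): `m` is a limit ordinal, and `C` is a subset of `m = {a | a < m}` that is closed
and unbounded in `m`. -/
def IsClubIn {l : Ordinal.{v}} (C : Set (Iio l)) (m : Iio l) : Prop :=
  Order.IsSuccLimit (m : Ordinal.{v}) ∧ C ⊆ Iio m ∧ IsClub ((↑) ⁻¹' C : Set (Iio m))

/-- `(S, k)` is a spine, over the ordinal `l`, of the space `X` which is simple with `x`. -/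
structure IsSpine {X : Type u} [TopologicalSpace X] {l : Ordinal.{v}} (x : X)
    (S : Set X) (k : X → Iio l) : Prop where
  notMem : x ∉ S
  cleaves : CleavesAlong k S
  isEmbedding : IsEmbedding (S.domRestrict k)
  isClubIn : IsClubIn (k '' S) (k x)

/-- `X`, which is simple with `x`, has a spine `(S, k)` over `l` with `S ∪ {x}` closed in `X`.
The closedness is what ties the spine to the point `x`; it does not follow from `IsSpine` alone,
since `k` may take the value `k x` at other points. -/
def HasSpine (X : Type u) [TopologicalSpace X] (l : Ordinal.{v}) (x : X) : Prop :=
  ∃ (S : Set X) (k : X → Iio l), IsSpine x S k ∧ IsClosed (insert x S)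

/-- Every closed, infinite, simple subspace of `X` has a spine. -/
def HereditarilyHasSpine (X : Type u) [TopologicalSpace X] (l : Ordinal.{v}) : Prop :=
  ∀ A : Set X, IsClosed A → A.Infinite → ∀ a : A, IsSimpleWith A a → HasSpine A l a

/-! Simplicity enters only through the fact that x̂ is not isolated. A map cleaving along {x̂} then
has a limit value at x̂, and collapsing it gives f with f⁻¹(κ) = {x̂}, κ regular. By compactness f
is bounded below κ on each closed set missing x̂.

Pick one point p c in each fibre of f below κ, as a limit of earlier choices whenever c is a limit
of values (`exists_selection`), and cleave along the chosen points by g. A g-fibre through a chosen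
point far enough out consists of chosen points, but possibly of several. Regularity of κ thins the
indices to a club D along which g ∘ p rises and sublevel sets of g and f interlace
(`exists_interlacingClub`).

The spine is p(D) with k = max(g, level ∘ f): the second term lifts points with large f, so that
k-fibres through p(D) are singletons (`eq_select_of_max_level_eq`). The limit choices make p(D) ∪
{x̂} closed, hence compact, and k embeds it. Subspaces inherit cleavability, which gives (b). -/

theorem exists_wellFounded_choice {α β : Type*} [LT α] [WellFoundedLT α]
    (Q : ∀ a : α, (∀ b, b < a → β) → β → Prop) (h : ∀ a q, ∃ x, Q a q x) :
    ∃ p : α → β, ∀ a, Q a (fun b _ => p b) (p a) := by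
  choose F hF using h
  refine ⟨wellFounded_lt.fix F, fun a => ?_⟩
  rw [wellFounded_lt.fix_eq F a]
  exact hF a _

/-! ### Topology of ordinals and continuous maps into them -/

namespace Ordinal

theorem exists_bound_of_ord_cof_eq {κ b : Ordinal.{v}} (h : κ.cof.ord = κ) (hb : b < κ)
    (φ : Ordinal.{v} → Ordinal.{v}) (hφ : ∀ i < b, φ i < κ) : ∃ s < κ, ∀ i < b, φ i ≤ s := by
  refine ⟨sSup (φ '' Iio b), ?_, fun i hi => ?_⟩
  · refine sSup_lt_of_lt_cof ?_ (by rintro _ ⟨i, hi, rfl⟩; exact hφ i hi)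
    refine Cardinal.mk_image_le.trans_lt ?_
    rw [Cardinal.mk_Iio_ordinal, ← lift_cof, Cardinal.lift_lt]
    rwa [← Cardinal.lt_ord, h]
  · exact le_csSup bddAbove_of_small ⟨i, hi, rfl⟩

theorem isClopen_Iic (a : Ordinal.{v}) : IsClopen (Iic a) :=
  ⟨_root_.isClosed_Iic, by rw [← Order.Iio_succ]; exact isOpen_Iio⟩

theorem isClopen_Ioi (a : Ordinal.{v}) : IsClopen (Ioi a) := by
  rw [← compl_Iic]; exact (isClopen_Iic a).compl

theorem continuous_of_isClopen_le {X : Type u} [TopologicalSpace X] {F : X → Ordinal.{v}}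
    (h : ∀ a, IsClopen {x | F x ≤ a}) : Continuous F := by
  rw [OrderTopology.topology_eq_generate_intervals (α := Ordinal.{v}), continuous_generateFrom_iff]
  rintro s ⟨a, rfl | rfl⟩
  · convert (h a).compl.isOpen using 1
    ext x; simp
  · convert isOpen_biUnion fun b (_ : b ∈ Iio a) => (h b).isOpen using 1
    ext x
    simp only [mem_preimage, mem_Iio, mem_iUnion, mem_ofPred_eq, exists_prop]
    exact ⟨fun hx => ⟨_, hx, le_rfl⟩, fun ⟨b, hb, hx⟩ => hx.trans_lt hb⟩

theorem exists_mem_Ioo_of_mem_closure {D : Set Ordinal.{v}} {e y : Ordinal.{v}}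
    (he : e ∈ closure (D ∩ Iio e)) (hy : y < e) : ∃ d ∈ D, y < d ∧ d < e := by
  obtain ⟨d, hd, hdD, hde⟩ := mem_closure_iff.1 he (Ioi y) isOpen_Ioi hy
  exact ⟨d, hdD, hd, hde⟩

theorem sSup_mem_of_closed_below {D B : Set Ordinal.{v}} {κ : Ordinal.{v}}
    (hD : ∀ e < κ, e ∈ closure (D ∩ Iio e) → e ∈ D) (hBD : B ⊆ D) (hB : B.Nonempty)
    {y : Ordinal.{v}} (hBy : ∀ b ∈ B, b ≤ y) (hy : y < κ) : sSup B ∈ D := by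
  have hbdd : BddAbove B := ⟨y, hBy⟩
  by_cases h : sSup B ∈ B
  · exact hBD h
  · refine hD _ ((csSup_le hB hBy).trans_lt hy) (closure_mono ?_ (csSup_mem_closure hB hbdd))
    intro b hb
    exact ⟨hBD hb, lt_of_le_of_ne (le_csSup hbdd hb) fun he => h (he ▸ hb)⟩

end Ordinal

/-- Collapsing along a fundamental sequence makes the value at `x` a regular ordinal. -/
theorem exists_continuous_regular {X : Type u} [TopologicalSpace X] {x : X} {f : X → Ordinal.{v}}
    (hf : Continuous f) (hfx : ∀ z, f z = f x → z = x) (hlim : Order.IsSuccLimit (f x)) :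
    ∃ (κ : Ordinal.{v}) (F : X → Ordinal.{v}), κ.cof.ord = κ ∧ Order.IsSuccLimit κ ∧
      Continuous F ∧ (∀ z, F z ≤ κ) ∧ ∀ z, F z = κ ↔ z = x := by
  set α := f x with hα
  set κ := α.cof.ord with hκ
  obtain ⟨b, hb⟩ := Ordinal.exists_isFundamentalSeq (o := α) (a := κ) rfl
  let b' : Ordinal.{v} → Ordinal.{v} := fun i => if h : i < κ then b ⟨i, h⟩ else α
  have hb'κ : ∀ i, i < κ → b' i < α := fun i hi => by
    simp only [b', dif_pos hi]; exact (b ⟨i, hi⟩).2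
  have hb'α : ∀ i, κ ≤ i → b' i = α := fun i hi => by simp only [b', dif_neg hi.not_gt]
  have hmono : Monotone b' := by
    intro i j hij
    rcases lt_or_ge j κ with hj | hj
    · simp only [b', dif_pos hj, dif_pos (hij.trans_lt hj)]
      exact hb.strictMono.monotone (Subtype.mk_le_mk.2 hij)
    · rw [hb'α j hj]
      rcases lt_or_ge i κ with hi | hi
      · exact (hb'κ i hi).le
      · exact (hb'α i hi).le
  -- Least index whose cofinal term bounds `f z`; values above `α` go to 0, so that `κ` becomes the
  -- maximum.
  let F : X → Ordinal.{v} := fun z => sInf {i | f z ≤ b' i ∨ α < f z}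
  have hκmem : ∀ z, f z ≤ b' κ ∨ α < f z := fun z => by
    rw [hb'α κ le_rfl]; exact le_or_gt _ _
  have hF : ∀ z i, F z ≤ i ↔ f z ≤ b' i ∨ α < f z := by
    intro z i
    constructor
    · intro h
      rcases csInf_mem (s := {i | f z ≤ b' i ∨ α < f z}) ⟨κ, hκmem z⟩ with h' | h'
      · exact Or.inl (h'.trans (hmono h))
      · exact Or.inr h'
    · exact fun h => csInf_le' h
  have hreg : κ.cof.ord = κ := by rw [hκ, Ordinal.cof_ord_cof]
  refine ⟨κ, F, hreg, ?_, ?_, fun z => (hF z κ).2 (hκmem z), fun z => ⟨fun h => ?_, ?_⟩⟩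
  · rw [← Ordinal.one_lt_cof_iff, hκ, Ordinal.cof_ord_cof]
    exact Ordinal.one_lt_cof_iff.2 hlim
  · refine Ordinal.continuous_of_isClopen_le fun i => ?_
    have : {z | F z ≤ i} = f ⁻¹' (Iic (b' i) ∪ Ioi α) := by ext z; simp [hF]
    rw [this]
    exact ((Ordinal.isClopen_Iic _).union (Ordinal.isClopen_Ioi _)).preimage hf
  · apply hfx
    have h1 : ∀ i < κ, ¬ (f z ≤ b' i ∨ α < f z) := fun i hi h' =>
      absurd ((hF z i).2 h') (by rw [h]; exact hi.not_ge)
    by_contra hne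
    rcases lt_or_gt_of_ne hne with hlt | hgt
    · obtain ⟨_, ⟨i, rfl⟩, hi⟩ := hb.isCofinal_range ⟨f z, hlt⟩
      refine h1 i i.2 (Or.inl ?_)
      simp only [b', dif_pos (show (i : Ordinal) < κ from i.2)]
      exact hi
    · refine h1 0 ?_ (Or.inr hgt)
      rw [hκ, _root_.pos_iff_ne_zero, Ne, Cardinal.ord_eq_zero, Ordinal.cof_eq_zero]
      exact hlim.ne_bot
  · rintro rfl
    refine le_antisymm ((hF z κ).2 (hκmem z)) (le_of_not_gt fun h => ?_)
    rcases (hF z (F z)).1 le_rfl with h' | h'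
    · exact absurd (h'.trans_lt (hb'κ _ h)) (lt_irrefl _)
    · exact lt_irrefl _ h'

theorem exists_bound_of_isClosed {X : Type u} [TopologicalSpace X] [CompactSpace X] {x : X}
    {κ : Ordinal.{v}} {f : X → Ordinal.{v}} (hf : Continuous f) (hκ : 0 < κ)
    (hfκ : ∀ z, f z ≤ κ) (hfx : ∀ z, f z = κ ↔ z = x) {K : Set X} (hK : IsClosed K)
    (hxK : x ∉ K) : ∃ b < κ, ∀ z ∈ K, f z ≤ b := by
  rcases K.eq_empty_or_nonempty with rfl | h
  · exact ⟨0, hκ, fun z hz => hz.elim⟩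
  · obtain ⟨m, hm, hmax⟩ := hK.isCompact.exists_isMaxOn h hf.continuousOn
    exact ⟨f m, lt_of_le_of_ne (hfκ m) fun he => hxK ((hfx m).1 he ▸ hm), fun z hz => hmax hz⟩

/-- The closure of the earlier choices is compact, so its image is closed and contains every limit
of earlier values. -/
theorem exists_selection {X : Type u} [TopologicalSpace X] [CompactSpace X] [Nonempty X]
    {f : X → Ordinal.{v}} (hf : Continuous f) :
    ∃ p : Ordinal.{v} → X, ∀ c ∈ range f, f (p c) = c ∧
      (c ∈ closure (range f ∩ Iio c) → p c ∈ closure (p '' (range f ∩ Iio c))) := by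
  obtain ⟨p, hp⟩ := exists_wellFounded_choice (α := Ordinal.{v}) (β := X)
    -- The guard on earlier choices keeps each stage satisfiable; induction discharges it
    -- afterwards.
    (fun c q z => c ∈ range f → (∀ b (hb : b < c), b ∈ range f → f (q b hb) = b) →
      f z = c ∧ (c ∈ closure (range f ∩ Iio c) →
        z ∈ closure {y | ∃ b, ∃ hb : b < c, b ∈ range f ∧ q b hb = y}))
    (by
      intro c q
      by_cases hc : c ∈ range f
      swap
      · exact ⟨Classical.arbitrary X, fun h => absurd h hc⟩
      by_cases hq : ∀ b (hb : b < c), b ∈ range f → f (q b hb) = b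
      swap
      · exact ⟨Classical.arbitrary X, fun _ h => absurd h hq⟩
      by_cases hcl : c ∈ closure (range f ∩ Iio c)
      swap
      · obtain ⟨z, hz⟩ := hc
        exact ⟨z, fun _ _ => ⟨hz, fun h => absurd h hcl⟩⟩
      set Y := {y | ∃ b, ∃ hb : b < c, b ∈ range f ∧ q b hb = y}
      have hcpt : IsClosed (f '' closure Y) := (isClosed_closure.isCompact.image hf).isClosed
      obtain ⟨z, hz, hzc⟩ := closure_minimal (s := range f ∩ Iio c) (t := f '' closure Y)
        (fun b hb => ⟨q b hb.2, subset_closure ⟨b, hb.2, hb.1, rfl⟩, hq b hb.2 hb.1⟩) hcpt hcl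
      exact ⟨z, fun _ _ => ⟨hzc, fun _ => hz⟩⟩)
  have hfp : ∀ c, c ∈ range f → f (p c) = c := by
    intro c
    induction c using WellFoundedLT.induction with
    | ind c ih => exact fun hc => (hp c hc fun b hb hb' => ih b hb hb').1
  refine ⟨p, fun c hc => ⟨hfp c hc, fun hcl => ?_⟩⟩
  refine closure_mono ?_ ((hp c hc fun b _ hb' => hfp b hb').2 hcl)
  rintro _ ⟨b, hb, hb', rfl⟩
  exact ⟨b, ⟨hb', hb⟩, rfl⟩

/-- `f` shrinks to the point `x` at the regular ordinal `κ`, and `p` selects points of the fibres of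
`f` over the club `C` of `κ`, whose set of values is cleaved off by `g`. -/
structure CleavedSelection {X : Type u} [TopologicalSpace X] (x : X) (κ γ : Ordinal.{v})
    (f g : X → Ordinal.{v}) (C : Set Ordinal.{v}) (p : Ordinal.{v} → X) : Prop where
  regular : κ.cof.ord = κ
  isSuccLimit : Order.IsSuccLimit κ
  continuous_fst : Continuous f
  continuous_snd : Continuous g
  fst_le : ∀ z, f z ≤ κ
  fst_eq_iff : ∀ z, f z = κ ↔ z = x
  snd_le : ∀ z, g z ≤ γ
  snd_apply : g x = γ
  lt_of_mem : ∀ c ∈ C, c < κ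
  unbounded : ∀ y < κ, ∃ c ∈ C, y < c
  closed : ∀ e < κ, e ∈ closure C → e ∈ C
  fst_select : ∀ c ∈ C, f (p c) = c
  snd_select_lt : ∀ c ∈ C, g (p c) < γ
  select_mem_closure : ∀ c ∈ C, c ∈ closure (C ∩ Iio c) → p c ∈ closure (p '' (C ∩ Iio c))
  cleaves : ∀ c ∈ C, ∀ z, g z = g (p c) → f z ∈ C ∧ p (f z) = z

/-- A club `D` in `κ`, contained in `C`, along which `g ∘ p` increases so fast that the sublevel
sets of `g` and the sublevel sets of `f` interlace. -/
structure InterlacingClub {X : Type u} (κ : Ordinal.{v})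
    (f g : X → Ordinal.{v}) (C : Set Ordinal.{v}) (p : Ordinal.{v} → X) (D : Set Ordinal.{v}) :
    Prop where
  subset : D ⊆ C
  record : ∀ c ∈ D, ∀ b ∈ C, b < c → g (p b) < g (p c)
  interlace : ∀ c ∈ D, ∀ d ∈ D, d < c → ∀ z, g z ≤ g (p d) + 1 → f z < c
  unbounded : ∀ y < κ, ∃ d ∈ D, y < d
  closed : ∀ e < κ, e ∈ closure (D ∩ Iio e) → e ∈ D

/-! ### The level function -/

namespace InterlacingClub

variable {X : Type u} {κ : Ordinal.{v}} {f g : X → Ordinal.{v}} {C D : Set Ordinal.{v}}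
  {p : Ordinal.{v} → X}

/-- The least strict upper bound of the values of `g ∘ p` on the part of `D` below `y`. -/
noncomputable def level (g : X → Ordinal.{v}) (p : Ordinal.{v} → X) (D : Set Ordinal.{v})
    (y : Ordinal.{v}) : Ordinal.{v} :=
  sSup ((fun d => g (p d) + 1) '' (D ∩ Iio y))

theorem level_le_iff {y a : Ordinal.{v}} :
    level g p D y ≤ a ↔ ∀ d ∈ D, d < y → g (p d) + 1 ≤ a := by
  have hs : Small.{v} ↑(D ∩ Iio y) := small_subset (inter_subset_right)
  rw [level, csSup_le_iff' Ordinal.bddAbove_of_small]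
  simp only [mem_image, mem_inter_iff, mem_Iio]
  constructor
  · exact fun h d hd hdy => h _ ⟨d, ⟨hd, hdy⟩, rfl⟩
  · rintro h _ ⟨d, ⟨hd, hdy⟩, rfl⟩
    exact h d hd hdy

/-- The strict bound `d < y` makes each sublevel set everything or a closed initial segment, which
is clopen. -/
theorem continuous_level : Continuous (level g p D) := by
  refine Ordinal.continuous_of_isClopen_le fun a => ?_
  set E : Set Ordinal.{v} := {d | d ∈ D ∧ a < g (p d) + 1}
  have hE : {y | level g p D y ≤ a} = {y | ∀ d ∈ E, y ≤ d} := by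
    ext y
    simp only [mem_ofPred_eq, level_le_iff, E]
    exact ⟨fun h d hd => le_of_not_gt fun hlt => absurd hd.2 (h d hd.1 hlt).not_gt,
      fun h d hd hlt => le_of_not_gt fun h' => absurd hlt (h d ⟨hd, h'⟩).not_gt⟩
  rw [hE]
  rcases E.eq_empty_or_nonempty with h | h
  · simpa [h] using isClopen_univ
  · convert Ordinal.isClopen_Iic (sInf E) using 1
    ext y
    exact (le_csInf_iff (OrderBot.bddBelow E) h).symm

theorem level_le (hD : InterlacingClub κ f g C p D) {c : Ordinal.{v}} (hc : c ∈ D) :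
    level g p D c ≤ g (p c) :=
  level_le_iff.2 fun d hd hdc => Order.succ_le_of_lt (hD.record c hc d (hD.subset hd) hdc)

end InterlacingClub

open InterlacingClub

/-! ### Existence of interlacing clubs -/

namespace CleavedSelection

variable {X : Type u} [TopologicalSpace X] {x : X} {κ γ : Ordinal.{v}}
  {f g : X → Ordinal.{v}} {C D : Set Ordinal.{v}} {p : Ordinal.{v} → X}

theorem pos (h : CleavedSelection x κ γ f g C p) : 0 < κ :=
  _root_.pos_iff_ne_zero.2 h.isSuccLimit.ne_bot

theorem exists_bound [CompactSpace X] (h : CleavedSelection x κ γ f g C p) {δ : Ordinal.{v}}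
    (hδ : δ < γ) : ∃ b < κ, ∀ z, g z ≤ δ → f z ≤ b :=
  exists_bound_of_isClosed h.continuous_fst h.pos h.fst_le h.fst_eq_iff
    (isClosed_Iic.preimage h.continuous_snd) fun hx => hδ.not_ge (h.snd_apply ▸ hx)

theorem isSuccLimit_snd [CompactSpace X] (h : CleavedSelection x κ γ f g C p) :
    Order.IsSuccLimit γ := by
  obtain ⟨c₀, hc₀, -⟩ := h.unbounded 0 h.pos
  refine Ordinal.isSuccLimit_iff.2 ⟨fun h0 => ?_, Order.isSuccPrelimit_of_succ_lt fun δ hδ => ?_⟩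
  · have := h.snd_select_lt c₀ hc₀
    simp [h0] at this
  · obtain ⟨b, hb, hbδ⟩ := h.exists_bound hδ
    obtain ⟨c, hc, hbc⟩ := h.unbounded b hb
    refine lt_of_le_of_lt (Order.succ_le_of_lt (lt_of_not_ge fun hle => ?_)) (h.snd_select_lt c hc)
    have := hbδ _ hle
    rw [h.fst_select c hc] at this
    exact absurd hbc this.not_gt

/-- Recursion puts into `D` every index meeting the demands set by earlier ones. If `D` were
bounded, its demands would be bounded too, and regularity would supply a further member. -/
theorem exists_interlacingClub [CompactSpace X] (h : CleavedSelection x κ γ f g C p) :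
    ∃ D, InterlacingClub κ f g C p D := by
  obtain ⟨P, hP⟩ := exists_wellFounded_choice (α := Ordinal.{v}) (β := Prop)
    (fun c Q q => q ↔ (c ∈ C ∧ (∀ b ∈ C, b < c → g (p b) < g (p c)) ∧
      ∀ d (hd : d < c), Q d hd → ∀ z, g z ≤ g (p d) + 1 → f z < c))
    (fun _ _ => ⟨_, Iff.rfl⟩)
  set D : Set Ordinal.{v} := {c | P c} with hD
  have hmem : ∀ c, c ∈ D ↔ (c ∈ C ∧ (∀ b ∈ C, b < c → g (p b) < g (p c)) ∧
      ∀ d, d < c → d ∈ D → ∀ z, g z ≤ g (p d) + 1 → f z < c) := fun c => hP c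
  have hclosed : ∀ e < κ, e ∈ closure (D ∩ Iio e) → e ∈ D := by
    intro e he hcl
    have heC : e ∈ C := h.closed e he
      (closure_mono (fun d hd => ((hmem d).1 hd.1).1) hcl)
    refine (hmem e).2 ⟨heC, fun b hb hbe => ?_, fun d hde hd z hz => ?_⟩
    · obtain ⟨d, hd, hbd, hde⟩ := Ordinal.exists_mem_Ioo_of_mem_closure hcl hbe
      obtain ⟨d', hd', hdd', hde'⟩ := Ordinal.exists_mem_Ioo_of_mem_closure hcl hde
      refine (((hmem d).1 hd).2.1 b hb hbd).trans (lt_of_not_ge fun hle => ?_)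
      have := ((hmem d').1 hd').2.2 d hdd' hd (p e) (hle.trans (Order.le_succ _))
      rw [h.fst_select e heC] at this
      exact absurd this hde'.not_gt
    · obtain ⟨d', hd', hdd', hde'⟩ := Ordinal.exists_mem_Ioo_of_mem_closure hcl hde
      exact (((hmem d').1 hd').2.2 d hdd' hd z hz).trans hde'
  refine ⟨D, fun d hd => ((hmem d).1 hd).1, fun c hc => ((hmem c).1 hc).2.1,
    fun c hc d hd hdc => ((hmem c).1 hc).2.2 d hdc hd, ?_, hclosed⟩
  by_contra! hbd
  obtain ⟨y, hy, hDy⟩ := hbd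
  have hδ : ∃ δ < γ, ∀ d ∈ D, g (p d) + 1 ≤ δ := by
    rcases D.eq_empty_or_nonempty with hE | hE
    · exact ⟨0, _root_.pos_iff_ne_zero.2 h.isSuccLimit_snd.ne_bot, by simp [hE]⟩
    · have he : sSup D ∈ D := Ordinal.sSup_mem_of_closed_below hclosed subset_rfl hE hDy hy
      refine ⟨g (p (sSup D)) + 1,
        h.isSuccLimit_snd.succ_lt (h.snd_select_lt _ ((hmem _).1 he).1), fun d hd => ?_⟩
      rcases (le_csSup ⟨y, hDy⟩ hd).eq_or_lt with heq | hlt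
      · rw [← heq]
      · exact add_le_add_left (((hmem _).1 he).2.1 d ((hmem d).1 hd).1 hlt).le 1
  obtain ⟨δ, hδγ, hδ⟩ := hδ
  obtain ⟨b, hb, hbδ⟩ := h.exists_bound hδγ
  have hφ : ∀ i, ∃ s < κ, i ∈ C → ∀ z, g z ≤ g (p i) → f z ≤ s := by
    intro i
    by_cases hi : i ∈ C
    · obtain ⟨s, hs, hs'⟩ := h.exists_bound (h.snd_select_lt i hi)
      exact ⟨s, hs, fun _ => hs'⟩
    · exact ⟨0, h.pos, fun h' => absurd h' hi⟩
  choose φ hφκ hφ using hφ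
  -- Regularity: one bound for all indices up to `max b y`, so points of `C` beyond it exceed all
  -- their `g`-values.
  obtain ⟨s, hs, hφs⟩ := Ordinal.exists_bound_of_ord_cof_eq h.regular
    (h.isSuccLimit.succ_lt (max_lt hb hy)) φ (fun i _ => hφκ i)
  set E : Set Ordinal.{v} := {c | c ∈ C ∧ max b y < c ∧ ∀ i ∈ C, i ≤ max b y → g (p i) < g (p c)}
  have hEne : E.Nonempty := by
    obtain ⟨c, hc, hlt⟩ := h.unbounded _ (max_lt hs (max_lt hb hy))
    refine ⟨c, hc, (le_max_right _ _).trans_lt hlt, fun i hi hib => lt_of_not_ge fun hle => ?_⟩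
    have h1 := hφ i hi _ hle
    rw [h.fst_select c hc] at h1
    have h2 := h1.trans (hφs i (Order.lt_succ_of_le hib))
    exact absurd ((le_max_left _ _).trans_lt hlt) h2.not_gt
  obtain ⟨hcC, hcb, hcr⟩ := csInf_mem hEne
  set c := sInf E
  have hcD : c ∈ D := by
    refine (hmem c).2 ⟨hcC, fun i hi hic => ?_, fun d _ hd z hz => ?_⟩
    · rcases le_or_gt i (max b y) with hib | hib
      · exact hcr i hi hib
      -- By minimality of `c`, `g (p i)` is dominated by some `g (p j)` with `j ≤ max b y`.
      · have : i ∉ E := notMem_of_lt_csInf' hic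
        by_contra hle
        exact this ⟨hi, hib, fun j hj hjb => (hcr j hj hjb).trans_le (not_lt.1 hle)⟩
    · exact (hbδ z (hz.trans (hδ d hd))).trans_lt ((le_max_left _ _).trans_lt hcb)
  exact absurd (hDy c hcD) ((le_max_right _ _).trans_lt hcb).not_ge

/-! ### Fibres of the spine map and closedness of the spine -/

variable (h : CleavedSelection x κ γ f g C p) (hD : InterlacingClub κ f g C p D)
include h hD

/-- The part of `D` below `y` has a greatest element `e`, so the level is at most `g (p e) + 1`;
interlacing at `p c` keeps `g (p c)` above that. -/
theorem level_lt {y c : Ordinal.{v}} (hc : c ∈ D) (hy : y < c) (hne : (D ∩ Iio y).Nonempty) :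
    level g p D y < g (p c) := by
  have hyκ : y < κ := hy.trans (h.lt_of_mem c (hD.subset hc))
  have hle : ∀ b ∈ D ∩ Iio y, b ≤ y := fun b hb => hb.2.le
  have he := Ordinal.sSup_mem_of_closed_below hD.closed inter_subset_left hne hle hyκ
  have hec : sSup (D ∩ Iio y) < c := (csSup_le hne hle).trans_lt hy
  have h1 : level g p D y ≤ g (p (sSup (D ∩ Iio y))) + 1 := level_le_iff.2 fun d hd hdy => by
    rcases (le_csSup ⟨y, hle⟩ (show d ∈ D ∩ Iio y from ⟨hd, hdy⟩)).eq_or_lt with heq | hlt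
    · rw [← heq]
    · exact add_le_add_left (hD.record _ he d (hD.subset hd) hlt).le 1
  refine h1.trans_lt (lt_of_not_ge fun hge => ?_)
  have := hD.interlace c hc _ he hec (p c) hge
  rw [h.fst_select c (hD.subset hc)] at this
  exact lt_irrefl _ this

theorem level_le_top (y : Ordinal.{v}) : level g p D y ≤ γ :=
  level_le_iff.2 fun d hd _ => Order.succ_le_of_lt (h.snd_select_lt d (hD.subset hd))

theorem max_level_select {c : Ordinal.{v}} (hc : c ∈ D) :
    max (g (p c)) (level g p D (f (p c))) = g (p c) := by
  rw [h.fst_select c (hD.subset hc)]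
  exact max_eq_left (hD.level_le hc)

/-- If `f z > c`, the level is too big. If `g z = g (p c)`, then `z` is a chosen point and the
record property excludes `f z < c`. Otherwise the level attains `g (p c)`: impossible below `c` by
`level_lt`, and at `c` because interlacing would force `f z < c`. -/
theorem eq_select_of_max_level_eq {c : Ordinal.{v}} (hc : c ∈ D) {z : X}
    (hz : max (g z) (level g p D (f z)) = g (p c)) : z = p c := by
  have hcC := hD.subset hc
  have hg : g z ≤ g (p c) := hz ▸ le_max_left _ _
  have hl : level g p D (f z) ≤ g (p c) := hz ▸ le_max_right _ _
  rcases lt_trichotomy (f z) c with hlt | heq | hgt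
  · exfalso
    have hgz : g z ≠ g (p c) := fun he => by
      obtain ⟨h1, h2⟩ := h.cleaves c hcC z he
      have := hD.record c hc _ h1 hlt
      rw [h2, he] at this
      exact lt_irrefl _ this
    have hlz : level g p D (f z) = g (p c) := by
      rcases max_choice (g z) (level g p D (f z)) with h' | h'
      · exact absurd (h' ▸ hz) hgz
      · exact h' ▸ hz
    rcases (D ∩ Iio (f z)).eq_empty_or_nonempty with hE | hE
    · have h0 : level g p D (f z) = 0 := by simp [level, hE]
      rw [h0] at hlz
      exact hgz (le_antisymm hg (hlz ▸ zero_le))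
    · exact absurd hlz (h.level_lt hD hc hlt hE).ne
  · by_cases hgz : g z = g (p c)
    · rw [← (h.cleaves c hcC z hgz).2, heq]
    · exfalso
      have hlz : level g p D (f z) = g (p c) := by
        rcases max_choice (g z) (level g p D (f z)) with h' | h'
        · exact absurd (h' ▸ hz) hgz
        · exact h' ▸ hz
      have hlt : g z < level g p D c := by
        rw [← heq, hlz]; exact lt_of_le_of_ne hg hgz
      have : ∃ d ∈ D, d < c ∧ g z < g (p d) + 1 := by
        by_contra! hcon
        exact absurd (level_le_iff.2 hcon) hlt.not_ge
      obtain ⟨d, hd, hdc, hgd⟩ := this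
      exact absurd heq (hD.interlace c hc d hd hdc z hgd.le).ne
  · exact absurd ((level_le_iff.1 hl) c hc hgt) (lt_add_one _).not_ge

theorem isClosed_insert_image : IsClosed (insert x (p '' D)) := by
  rw [← closure_subset_iff_isClosed, insert_eq, closure_union]
  have hclx : IsClosed ({x} : Set X) := by
    have : ({x} : Set X) = f ⁻¹' {κ} := by ext z; simp [h.fst_eq_iff]
    rw [this]
    exact isClosed_singleton.preimage h.continuous_fst
  rw [hclx.closure_eq]
  refine union_subset subset_union_left fun q hq => ?_
  by_cases hqx : q = x
  · exact Or.inl hqx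
  right
  by_contra hqS
  set e := f q with he
  have heκ : e < κ := lt_of_le_of_ne (h.fst_le q) fun h' => hqx ((h.fst_eq_iff q).1 h')
  have hfD : ∀ d ∈ D, f (p d) = d := fun d hd => h.fst_select d (hD.subset hd)
  -- Near `q` only earlier indices occur: `f ≤ e` excludes later ones, and `k` separates `q` from `p
  -- e`.
  have hsep : ∃ U, IsOpen U ∧ q ∈ U ∧ ∀ d ∈ D, p d ∈ U → d < e := by
    by_cases heD : e ∈ D
    · refine ⟨f ⁻¹' Iic e ∩ {z | max (g z) (level g p D (f z)) ≠ g (p e)},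
        ((Ordinal.isClopen_Iic e).isOpen.preimage h.continuous_fst).inter
          (isOpen_ne.preimage (h.continuous_snd.max (continuous_level.comp h.continuous_fst))),
        ⟨he.ge, fun h' => hqS ⟨e, heD, (h.eq_select_of_max_level_eq hD heD h').symm⟩⟩, ?_⟩
      rintro d hd ⟨hde, hne⟩
      rw [mem_preimage, hfD d hd] at hde
      exact lt_of_le_of_ne hde fun h' => hne (h' ▸ h.max_level_select hD hd)
    · refine ⟨f ⁻¹' Iic e, (Ordinal.isClopen_Iic e).isOpen.preimage h.continuous_fst, he.ge, ?_⟩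
      intro d hd hde
      rw [mem_preimage, hfD d hd] at hde
      exact lt_of_le_of_ne hde fun h' => heD (h' ▸ hd)
  obtain ⟨U, hU, hqU, hUD⟩ := hsep
  have hfreq : ∀ V, IsOpen V → q ∈ V → ∃ d ∈ D, d < e ∧ p d ∈ V := by
    intro V hV hqV
    obtain ⟨_, ⟨hV', hU'⟩, d, hd, rfl⟩ := mem_closure_iff.1 hq (V ∩ U) (hV.inter hU) ⟨hqV, hqU⟩
    exact ⟨d, hd, hUD d hd hU', hV'⟩
  have hecl : e ∈ closure (D ∩ Iio e) := by
    refine mem_closure_iff.2 fun O hO heO => ?_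
    obtain ⟨d, hd, hde, hdO⟩ := hfreq _ (hO.preimage h.continuous_fst) heO
    rw [mem_preimage, hfD d hd] at hdO
    exact ⟨d, hdO, hd, hde⟩
  have heD := hD.closed e heκ hecl
  have heC := hD.subset heD
  have hle : g q ≤ g (p e) := by
    by_contra! hlt
    obtain ⟨d, hd, hde, hdV⟩ := hfreq _ (isOpen_Ioi.preimage h.continuous_snd) hlt
    exact absurd (hD.record e heD d (hD.subset hd) hde) (not_lt_of_gt hdV)
  -- Otherwise some `b < e` in `C` has `g q < g (p b)`, yet records `d` in `(b, e)` with `p d` near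
  -- `q` have `g (p d) < g (p b)`.
  have hge : g (p e) ≤ g q := by
    by_contra! hlt
    obtain ⟨_, hV, b, ⟨hb, hbe⟩, rfl⟩ := mem_closure_iff.1 (h.select_mem_closure e heC
      (closure_mono (inter_subset_inter_left _ hD.subset) hecl)) _
      (isOpen_Ioi.preimage h.continuous_snd) hlt
    obtain ⟨d, hd, hde, hdV⟩ := hfreq (f ⁻¹' Ioi b ∩ g ⁻¹' Iio (g (p b)))
      ((isOpen_Ioi.preimage h.continuous_fst).inter (isOpen_Iio.preimage h.continuous_snd))
      ⟨hbe, hV⟩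
    have hbd : b < d := by simpa [hfD d hd] using hdV.1
    exact absurd (hD.record d hd b hb hbd) (not_lt_of_gt hdV.2)
  exact hqS ⟨e, heD, (h.cleaves e heC q (le_antisymm hle hge)).2⟩

theorem exists_lt_snd_select [CompactSpace X] {δ : Ordinal.{v}} (hδ : δ < γ) :
    ∃ d ∈ D, δ < g (p d) := by
  obtain ⟨b, hb, hbδ⟩ := h.exists_bound hδ
  obtain ⟨d, hd, hbd⟩ := hD.unbounded b hb
  refine ⟨d, hd, lt_of_not_ge fun hle => ?_⟩
  have := hbδ _ hle
  rw [h.fst_select d (hD.subset hd)] at this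
  exact absurd hbd this.not_gt

end CleavedSelection

/-! ### Cleavability and isolated points -/

theorem CleavesAlong.mem_of_apply_eq {X : Type u} {Y : Type v} [TopologicalSpace X] [TopologicalSpace Y]
    {f : X → Y} {A : Set X} (h : CleavesAlong f A) {y z : X} (hyz : f y = f z) (hz : z ∈ A) :
    y ∈ A := by
  by_contra hy
  have : f z ∈ f '' A ∩ f '' Aᶜ := ⟨⟨z, hz, rfl⟩, ⟨y, hy, hyz⟩⟩
  rw [h.2] at this
  exact this

theorem CleavableOver.subtype {X : Type u} {Y : Type v} [TopologicalSpace X] [TopologicalSpace Y]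
    (h : CleavableOver X Y) (A : Set X) : CleavableOver A Y := by
  intro B
  obtain ⟨f, hf, hfB⟩ := h (Subtype.val '' B)
  refine ⟨f ∘ Subtype.val, hf.comp continuous_subtype_val, ?_⟩
  rw [eq_empty_iff_forall_notMem] at hfB ⊢
  rintro y ⟨⟨a, ha, rfl⟩, b, hb, hab⟩
  refine hfB (f a) ⟨⟨a, ⟨a, ha, rfl⟩, rfl⟩, b, ?_, hab⟩
  rintro ⟨b', hb', hbb'⟩
  exact hb (Subtype.ext hbb' ▸ hb')

theorem IsSimpleWith.not_isOpen_singleton {X : Type u} [TopologicalSpace X] [Infinite X] {x : X}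
    (h : IsSimpleWith X x) : ¬ IsOpen ({x} : Set X) := by
  obtain ⟨β, -, hβ⟩ := h
  intro ho
  have hβ0 : β ≠ 0 := by
    rintro rfl
    rw [iteratedDerivedSet_zero] at hβ
    exact infinite_univ (hβ ▸ finite_singleton x)
  have h1 : x ∈ (univ : Set X)ᵈ[0 + 1] :=
    iteratedDerivedSet_antitone _ (by rw [zero_add]; exact Order.one_le_iff_ne_zero.2 hβ0)
      (hβ ▸ mem_singleton x)
  rw [iteratedDerivedSet_succ, iteratedDerivedSet_zero, relDerivedSet_apply] at h1
  have h2 := h1.1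
  rw [mem_derivedSet, accPt_iff_frequently] at h2
  exact h2 (Filter.eventually_of_mem (ho.mem_nhds rfl) fun y hy hy' => hy'.1 hy)

theorem isEmbedding_domRestrict_of_isCompact {X : Type u} {Y : Type v} [TopologicalSpace X]
    [TopologicalSpace Y] [T2Space Y] {k : X → Y} (hk : Continuous k) {K S : Set X}
    (hK : IsCompact K) (hinj : InjOn k K) (hS : S ⊆ K) : IsEmbedding (S.domRestrict k) := by
  have : CompactSpace K := isCompact_iff_compactSpace.1 hK
  have he : IsEmbedding (K.domRestrict k) :=
    (Continuous.isClosedEmbedding (hk.comp continuous_subtype_val)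
      (injOn_iff_injective.1 hinj)).isEmbedding
  exact he.comp (IsEmbedding.inclusion hS)

/-! ### Construction of the spine -/

section

variable {X : Type u} [TopologicalSpace X] [CompactSpace X] {l : Ordinal.{v}} {x : X}

theorem CleavableOver.exists_cleavedSelection (hcl : CleavableOver X (Iio l))
    (hx : ¬ IsOpen ({x} : Set X)) :
    ∃ (κ γ : Ordinal.{v}) (f g : X → Ordinal.{v}) (C : Set Ordinal.{v}) (p : Ordinal.{v} → X),
      γ < l ∧ CleavedSelection x κ γ f g C p := by
  have : Nonempty X := ⟨x⟩
  obtain ⟨f₀, hf₀⟩ := hcl {x}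
  have hf₀c : Continuous fun z => (f₀ z : Ordinal.{v}) := continuous_subtype_val.comp hf₀.1
  have hf₀x : ∀ z, (f₀ z : Ordinal.{v}) = f₀ x → z = x := fun z hz =>
    hf₀.mem_of_apply_eq (Subtype.ext hz) rfl
  have hlim : Order.IsSuccLimit (f₀ x : Ordinal.{v}) := by
    by_contra hn
    refine hx ?_
    convert (SuccOrder.isOpen_singleton_iff.2 hn).preimage hf₀c using 1
    ext z
    exact ⟨fun h => by rw [h]; rfl, fun h => hf₀x z h⟩
  obtain ⟨κ, f, hreg, hκ, hf, hfκ, hfx⟩ := exists_continuous_regular hf₀c hf₀x hlim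
  obtain ⟨p, hp⟩ := exists_selection hf
  obtain ⟨g₀, hg₀⟩ := hcl (p '' (range f ∩ Iio κ))
  have hg₀c : Continuous fun z => (g₀ z : Ordinal.{v}) := continuous_subtype_val.comp hg₀.1
  have hκ0 : 0 < κ := _root_.pos_iff_ne_zero.2 hκ.ne_bot
  set γ : Ordinal.{v} := (g₀ x).1 with hγ
  have hxf : f x = κ := (hfx x).2 rfl
  have hfp : ∀ c ∈ range f, f (p c) = c := fun c hc => (hp c hc).1
  -- The set `g₀ > γ` is closed and misses `x`, so it lies in the clopen set `f ≤ y₀`, where `g` is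
  -- reset to `γ`.
  obtain ⟨y₀, hy₀, hy₀g⟩ : ∃ b < κ, ∀ z, γ < g₀ z → f z ≤ b :=
    exists_bound_of_isClosed hf hκ0 hfκ hfx
      ((Ordinal.isClopen_Ioi γ).isClosed.preimage hg₀c) (lt_irrefl γ)
  classical
  set C : Set Ordinal.{v} := range f ∩ Iio κ ∩ Ioi y₀ with hC
  set g : X → Ordinal.{v} := fun z => if f z ≤ y₀ then γ else g₀ z with hg
  have hgp : ∀ c ∈ C, g (p c) = g₀ (p c) := fun c hc => by
    rw [hg]; simp only [hfp c hc.1.1]; exact if_neg (not_le_of_gt hc.2)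
  have hltC : ∀ c ∈ C, (g₀ (p c) : Ordinal.{v}) < γ := by
    intro c hc
    refine lt_of_le_of_ne (le_of_not_gt fun h => ?_) fun h => ?_
    · have := hy₀g _ h
      rw [hfp c hc.1.1] at this
      exact absurd hc.2 (not_lt_of_ge this)
    · obtain ⟨c', hc', hc'x⟩ := hg₀.mem_of_apply_eq (y := x) (z := p c) (Subtype.ext h.symm)
        ⟨c, hc.1, rfl⟩
      have h1 := hfp c' hc'.1
      rw [hc'x, hxf] at h1
      exact absurd hc'.2 (by simp [← h1])
  refine ⟨κ, γ, f, g, C, p, (g₀ x).2, ⟨hreg, hκ, hf, ?_, hfκ, hfx, fun z => ?_, ?_,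
    fun c hc => hc.1.2, fun y hy => ?_, fun e he hecl => ?_, fun c hc => hfp c hc.1.1,
    fun c hc => (hgp c hc).trans_lt (hltC c hc), fun c hc hccl => ?_, fun c hc z hz => ?_⟩⟩
  · refine continuous_const.if ?_ hg₀c
    intro z hz
    have : IsClopen {z | f z ≤ y₀} := (Ordinal.isClopen_Iic y₀).preimage hf
    rw [this.frontier_eq] at hz
    exact hz.elim
  · rw [hg]
    by_cases hz : f z ≤ y₀
    · simp [hz]
    · simp only [hz, if_false]
      exact le_of_not_gt fun h => hz (hy₀g z h)
  · rw [hg]; simp [hγ]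
  -- If `C` were bounded, `{x}` would be the preimage of an open ray.
  · by_contra! hcon
    refine hx ?_
    have hm : max y y₀ < κ := max_lt hy hy₀
    convert (isOpen_Ioi (a := max y y₀)).preimage hf using 1
    ext z
    constructor
    · rintro rfl
      rw [mem_preimage, hxf]
      exact hm
    · intro hz
      by_contra hzx
      have hlt : f z < κ := lt_of_le_of_ne (hfκ z) fun h => hzx ((hfx z).1 h)
      exact absurd (hcon (f z) ⟨⟨⟨z, rfl⟩, hlt⟩, (le_max_right y y₀).trans_lt (mem_Ioi.1 hz)⟩)
        (not_le_of_gt ((le_max_left y y₀).trans_lt (mem_Ioi.1 hz)))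
  · refine ⟨⟨?_, he⟩, ?_⟩
    · exact (isCompact_range hf).isClosed.closure_subset
        (closure_mono (fun c hc => hc.1.1) hecl)
    · exact (Ordinal.isClopen_Ioi y₀).isClosed.closure_subset
        (closure_mono (fun c hc => hc.2) hecl)
  · have h1 := (hp c hc.1.1).2 (closure_mono (inter_subset_inter_left _ fun c hc => hc.1.1) hccl)
    refine mem_closure_iff.2 fun O hO hcO => ?_
    obtain ⟨_, ⟨hO', hy⟩, b, hb, rfl⟩ := mem_closure_iff.1 h1 (O ∩ f ⁻¹' Ioi y₀)
      (hO.inter (isOpen_Ioi.preimage hf)) ⟨hcO, by rw [mem_preimage, hfp c hc.1.1]; exact hc.2⟩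
    rw [mem_preimage, hfp b hb.1] at hy
    exact ⟨p b, hO', b, ⟨⟨⟨hb.1, lt_trans (mem_Iio.1 hb.2) (mem_Iio.1 hc.1.2)⟩, hy⟩, hb.2⟩, rfl⟩
  · rw [hgp c hc] at hz
    have hzy : ¬ f z ≤ y₀ := fun h => by
      rw [hg] at hz; simp only [h, if_true] at hz
      exact (hltC c hc).ne hz.symm
    rw [hg] at hz; simp only [hzy, if_false] at hz
    obtain ⟨b, hb, rfl⟩ := hg₀.mem_of_apply_eq (y := z) (z := p c) (Subtype.ext hz) ⟨c, hc.1, rfl⟩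
    rw [hfp b hb.1] at hzy ⊢
    exact ⟨⟨hb, not_le.1 hzy⟩, rfl⟩

theorem CleavableOver.hasSpine (hcl : CleavableOver X (Iio l)) (hx : ¬ IsOpen ({x} : Set X)) :
    HasSpine X l x := by
  obtain ⟨κ, γ, f, g, C, p, hγl, h⟩ := hcl.exists_cleavedSelection hx
  obtain ⟨D, hD⟩ := h.exists_interlacingClub
  have hkle : ∀ z, max (g z) (InterlacingClub.level g p D (f z)) ≤ γ := fun z =>
    max_le (h.snd_le z) (h.level_le_top hD _)
  let k : X → Iio l := fun z => ⟨max (g z) (InterlacingClub.level g p D (f z)),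
    (hkle z).trans_lt hγl⟩
  have hk : Continuous k := (h.continuous_snd.max
    (InterlacingClub.continuous_level.comp h.continuous_fst)).subtype_mk _
  have hkx : (k x : Ordinal.{v}) = γ :=
    le_antisymm (hkle x) (h.snd_apply.ge.trans (le_max_left _ _))
  have hkp : ∀ d ∈ D, (k (p d) : Ordinal.{v}) = g (p d) := fun d hd => h.max_level_select hD hd
  have hfib : ∀ d ∈ D, ∀ z, k z = k (p d) → z = p d := fun d hd z hz =>
    h.eq_select_of_max_level_eq hD hd ((congrArg Subtype.val hz).trans (hkp d hd))
  have hlt : ∀ d ∈ D, k (p d) < k x := fun d hd => by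
    rw [← Subtype.coe_lt_coe, hkp d hd, hkx]
    exact h.snd_select_lt d (hD.subset hd)
  have hclosed := h.isClosed_insert_image hD
  have hinj : InjOn k (insert x (p '' D)) := by
    rintro y (rfl | ⟨d, hd, rfl⟩) z (rfl | ⟨d', hd', rfl⟩) hyz
    · rfl
    · exact hfib d' hd' _ hyz
    · exact (hfib d hd _ hyz.symm).symm
    · exact hfib d' hd' _ hyz
  refine ⟨p '' D, k, ⟨?_, ⟨hk, ?_⟩, ?_, ?_, ?_, ?_, ?_⟩, hclosed⟩
  · rintro ⟨d, hd, rfl⟩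
    exact lt_irrefl _ (hlt d hd)
  · rw [eq_empty_iff_forall_notMem]
    rintro _ ⟨⟨_, ⟨d, hd, rfl⟩, rfl⟩, z, hz, hzd⟩
    exact hz ⟨d, hd, (hfib d hd z hzd).symm⟩
  · exact isEmbedding_domRestrict_of_isCompact hk hclosed.isCompact hinj (subset_insert _ _)
  · rw [hkx]
    exact h.isSuccLimit_snd
  · rintro _ ⟨_, ⟨d, hd, rfl⟩, rfl⟩
    exact hlt d hd
  · intro s hs hne _ a ha
    -- Limits of `k(S)` lie in the compact set `k(S ∪ {x})`; those below `k x` lie in `k(S)`.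
    have hcl' : IsClosed (k '' insert x (p '' D)) := (hclosed.isCompact.image hk).isClosed
    have hacl : (a : Iio l) ∈ closure (Subtype.val '' s) :=
      image_closure_subset_closure_image continuous_subtype_val ⟨a, ha.mem_closure hne, rfl⟩
    obtain ⟨z, hz, hza⟩ := closure_minimal (by
      rintro _ ⟨b, hb, rfl⟩
      exact image_mono (subset_insert _ _) (hs hb)) hcl' hacl
    rcases hz with rfl | hz
    · exact absurd (mem_Iio.1 a.2) (hza ▸ lt_irrefl _)
    · exact ⟨z, hz, hza⟩
  · intro a
    have ha : ((a : Iio l) : Ordinal.{v}) < γ := hkx ▸ a.2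
    obtain ⟨d, hd, had⟩ := h.exists_lt_snd_select hD ha
    refine ⟨⟨k (p d), hlt d hd⟩, ⟨p d, ⟨d, hd, rfl⟩, rfl⟩, ?_⟩
    rw [← Subtype.coe_le_coe, ← Subtype.coe_le_coe, hkp d hd]
    exact had.le

end

theorem theorem4p1 {X : Type u} [TopologicalSpace X] [CompactSpace X] [Infinite X]
    (l : Ordinal.{v}) (hcl : CleavableOver X (Set.Iio l))
    (xhat : X) (hx : IsSimpleWith X xhat) :
    HasSpine X l xhat ∧ HereditarilyHasSpine X l := by
  refine ⟨hcl.hasSpine hx.not_isOpen_singleton, fun A hA hinf a ha => ?_⟩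
  have : CompactSpace A := isCompact_iff_compactSpace.1 hA.isCompact
  have : Infinite A := hinf.to_subtype
  exact (hcl.subtype A).hasSpine ha.not_isOpen_singleton
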